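/- Let $0<c\le C<\infty$ and $\alpha>0$, and for $n\in\mathbb N=\{1,2,\dots\}$ put $$r(n)=4c^{-1}\sqrt{(2+\alpha)\,\frac{\ln n}{n}}.$$ There is $n_0=n_0(c,C,\alpha)$ such that the following holds for every Borel probability measure $\mu$ on $[0,1]$ (with its Euclidean metric) that is absolutely continuous with respect to Lebesgue measure with a density $f$ satisfying $c\le f(x)\le C$ for every $x\in[0,1]$. For every $n\ge n_0$, $\mu$ is $(n,n^{-\alpha},r(n))$-disintegrable, that is: whenever $X_1,\dots,X_n$ are i.i.d. random variables with distribution $\mu$ on a probability space $(\Psi,\mathcal F,\mathbb P)$, there is an event of $\mathbb P$-probability at least $1-n^{-\alpha}$ on which there exist Borel probability measures $\mu_1,\dots,\mu_n$ on $[0,1]$ such that each $\mu_i$ is supported on the closed ball $B(X_i,r(n))$ and $\mu=\frac1n\sum_{i=1}^n\mu_i$ (a disintegration of $\mu$ along the multifunction $x\mapsto\{i: x\in B(X_i,r(n))\}$ with respect to the uniform measure on $\{1,\dots,n\}$). Consequently each such $\mu$ is asymptotically disintegrable with rate $(n^{-\alpha},r(n))$, i.e. $n^{-\alpha}$ and $r(n)$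 are nonnegative and tend to $0$, and $\mu$ is $(n,n^{-\alpha},r(n))$-disintegrable for all sufficiently large $n$; and $r(n)=O\big(\sqrt{\ln n/n}\big)$. -/

import Mathlib

open MeasureTheory ProbabilityTheory Filter Topology Asymptotics

universe u v w

/-- The (lower) inverse image `F⁻¹ B = {x | F x ∩ B ≠ ∅}` of a set `B` under a multifunction `F`,
that is, under an assignment of a (possibly empty) subset `F x ⊆ Y` to each `x : X`. -/
def multiPreimage {X : Type u} {Y : Type v} (F : X → Set Y) (B : Set Y) : Set X :=
  {x | (F x ∩ B).Nonempty}

/-- A multifunction is measurable if inverse images of measurable sets are measurable. -/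
def MeasurableMultifunction {X : Type u} {Y : Type v} [MeasurableSpace X] [MeasurableSpace Y]
    (F : X → Set Y) : Prop :=
  ∀ B : Set Y, MeasurableSet B → MeasurableSet (multiPreimage F B)

/-- `κ` is a disintegration of `μ` along the measurable multifunction `F` with respect to `ν`.
A Markov kernel is exactly a measurable family `y ↦ κ y` of probability measures on `X`. -/
structure IsDisintegration {X : Type u} {Y : Type v} [MeasurableSpace X] [MeasurableSpace Y]
    (μ : Measure X) (ν : Measure Y) (F : X → Set Y) (κ : Kernel Y X) : Prop where
  measurable_multifunction : MeasurableMultifunction F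
  isMarkov : IsMarkovKernel κ
  /-- `κ y` is carried by the fibre `F⁻¹ {y}` for `ν`-almost every `y`. -/
  supported : ∀ᵐ y ∂ν, κ y (multiPreimage F {y})ᶜ = 0
  /-- The disintegration formula `μ = ∫ κ y ν(dy)`. -/
  formula : ∀ A : Set X, MeasurableSet A → μ A = ∫⁻ y, κ y A ∂ν

/-- The multifunction `x ↦ {i | x ∈ B(xᵢ, r)}` given by closed balls of radius `r` centred at
the points of an `n`-tuple. -/
def ballMultifunction {X : Type u} [PseudoMetricSpace X] {n : ℕ} (r : ℝ) (c : Fin n → X) :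
    X → Set (Fin n) :=
  fun x => {i | x ∈ Metric.closedBall (c i) r}

/-- The metric probability space `(X, d, μ)` is `(n, ε, r)`-disintegrable: for any `X₁, …, Xₙ` that
are i.i.d. with distribution `μ` on a probability space `(Ω, P)`, there is an event of probability
at least `1 - ε` on which `μ` admits a disintegration along the multifunction of the balls
`B(Xᵢ, r)` with respect to the uniform measure on the `n` indices. -/
def IsDisintegrable {X : Type u} [MetricSpace X] [PolishSpace X] [MeasurableSpace X] [BorelSpace X]
    (μ : Measure X) (n : ℕ) (ε r : ℝ) : Prop :=
  ∀ (Ω : Type w) [MeasurableSpace Ω] (P : Measure Ω) [IsProbabilityMeasure P]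
    (ξ : Fin n → Ω → X), (∀ i, Measurable (ξ i)) → iIndepFun ξ P → (∀ i, P.map (ξ i) = μ) →
    ∃ E : Set Ω, MeasurableSet E ∧ 1 - ε ≤ P.real E ∧
      ∀ ω ∈ E, ∃ κ : Kernel (Fin n) X,
        IsDisintegration μ (uniformOn (Set.univ : Set (Fin n)))
          (ballMultifunction r (fun i => ξ i ω)) κ

/-- `(X, d, μ)` is asymptotically disintegrable with rate `(ε, r)`, for nonnegative functions
`ε, r` of `n ≥ 1` tending to zero. -/
structure IsAsymptoticallyDisintegrable {X : Type u} [MetricSpace X] [PolishSpace X]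
    [MeasurableSpace X] [BorelSpace X] (μ : Measure X) (ε r : ℕ → ℝ) : Prop where
  nonneg_fst : ∀ n, 0 < n → 0 ≤ ε n
  nonneg_snd : ∀ n, 0 < n → 0 ≤ r n
  tendsto_fst : Tendsto ε atTop (𝓝 0)
  tendsto_snd : Tendsto r atTop (𝓝 0)
  eventually_isDisintegrable : ∀ᶠ n : ℕ in atTop, IsDisintegrable.{u, w} μ n (ε n) (r n)

/-- The radius `r(n) = 4 c⁻¹ √((2 + α) ln n / n)`. -/
noncomputable def intervalRadius (c α : ℝ) (n : ℕ) : ℝ :=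
  4 * c⁻¹ * Real.sqrt ((2 + α) * (Real.log n / n))

/-! Cut `[0,1]` at the `k/n`-quantiles of `μ` into `n` blocks of mass `1/n`, and give the `k`-th
block to the `k`-th smallest sample point: `μ_i` is `n` times `μ` restricted to the block of `X_i`.
These measures average exactly to `μ`, so only the supports need an estimate
(`exists_isDisintegration_of_card_le_near`). Since the distribution function has slope at least `c`,
a block point farther than `r` from its sample point forces an empirical count, at some grid point
between them, to be off by at least `n * (c * r / 2)`. With `r = r(n)` this is a relative deviation
`2 * s`, where `s = √((2 + α) ln n / n)`. Hoeffding (`real_le_abs_card_sub_le`) bounds its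
probability at each grid point by `2 * n ^ (-8 * (2 + α))`, and a union bound over `n + 1` grid
points stays below `n ^ (-α)` once `n ≥ 2`. The upper bound `C` serves to make the distribution
function continuous, so that exact quantiles exist. -/

/-! ### The distribution function of `μ` -/

open Set in
lemma mul_sub_le_real_Ioc_of_withDensity {c : ℝ} {μ : Measure unitInterval}
    [IsProbabilityMeasure μ] {f : unitInterval → ℝ} (hc : 0 ≤ c) (hf : ∀ x, c ≤ f x)
    (hμ : μ = (volume : Measure unitInterval).withDensity (fun x => ENNReal.ofReal (f x)))
    (x y : unitInterval) : c * ((y : ℝ) - x) ≤ μ.real (Ioc x y) := by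
  have h : ENNReal.ofReal c * volume (Ioc x y) ≤ μ (Ioc x y) := by
    rw [hμ, withDensity_apply _ measurableSet_Ioc, ← setLIntegral_const]
    exact lintegral_mono fun z => ENNReal.ofReal_le_ofReal (hf z)
  rw [unitInterval.volume_Ioc, ← ENNReal.ofReal_mul hc] at h
  have h2 := (ENNReal.ofReal_le_iff_le_toReal (measure_ne_top μ _)).1 h
  exact h2

open Set in
lemma real_Ioc_le_mul_sub_of_withDensity {C : ℝ} {μ : Measure unitInterval}
    {f : unitInterval → ℝ} (hC : 0 ≤ C) (hf : ∀ x, f x ≤ C)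
    (hμ : μ = (volume : Measure unitInterval).withDensity (fun x => ENNReal.ofReal (f x)))
    {x y : unitInterval} (hxy : x ≤ y) : μ.real (Ioc x y) ≤ C * ((y : ℝ) - x) := by
  have h : μ (Ioc x y) ≤ ENNReal.ofReal C * volume (Ioc x y) := by
    rw [hμ, withDensity_apply _ measurableSet_Ioc, ← setLIntegral_const]
    exact lintegral_mono fun z => ENNReal.ofReal_le_ofReal (hf z)
  rw [unitInterval.volume_Ioc, ← ENNReal.ofReal_mul hC] at h
  exact ENNReal.toReal_le_of_le_ofReal (mul_nonneg hC (sub_nonneg.2 hxy)) h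

open Set in
lemma real_Iic_sub_real_Iic {μ : Measure unitInterval} [IsProbabilityMeasure μ]
    {x y : unitInterval} (hxy : x ≤ y) : μ.real (Iic y) - μ.real (Iic x) = μ.real (Ioc x y) := by
  rw [← Iic_union_Ioc_eq_Iic hxy, measureReal_union (Iic_disjoint_Ioc le_rfl) measurableSet_Ioc,
    add_sub_cancel_left]

-- The distribution function is `C`-Lipschitz, vanishes at `0` for lack of atoms and equals `1` at
-- `1`, so the intermediate value theorem applies.
open Set in
lemma exists_real_Iic_eq {C : ℝ} {μ : Measure unitInterval} [IsProbabilityMeasure μ]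
    [NullSingletonClass μ] (hC : 0 ≤ C)
    (hμ : ∀ x y : unitInterval, x ≤ y → μ.real (Ioc x y) ≤ C * ((y : ℝ) - x))
    {t : ℝ} (ht : t ∈ Icc (0 : ℝ) 1) : ∃ x : unitInterval, μ.real (Iic x) = t := by
  have hcont : Continuous fun x : unitInterval => μ.real (Iic x) := by
    refine (LipschitzWith.of_le_add_mul C.toNNReal fun x y => ?_).continuous
    rw [Real.coe_toNNReal _ hC, Subtype.dist_eq, Real.dist_eq]
    rcases le_total x y with h | h
    · have := measureReal_mono (μ := μ) (Iic_subset_Iic.2 h)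
      have : 0 ≤ C * |(x : ℝ) - y| := by positivity
      linarith
    · have h1 := hμ y x h
      rw [← real_Iic_sub_real_Iic h] at h1
      have := mul_le_mul_of_nonneg_left (le_abs_self ((x : ℝ) - y)) hC
      linarith
  have h0 : μ.real (Iic (0 : unitInterval)) = 0 := by
    have : Iic (0 : unitInterval) = {0} := by
      ext z; simp
    simp [this, measureReal_def]
  have h1 : μ.real (Iic (1 : unitInterval)) = 1 := by
    have : Iic (1 : unitInterval) = univ := Iic_top
    simp [this]
  have := intermediate_value_univ (0 : unitInterval) 1 hcont
  rw [h0, h1] at this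
  exact this ht

/-! ### Matching quantile blocks with order statistics -/

/-- The quantile blocks of `μ` are assigned to the sample points in increasing order. -/
lemma exists_isDisintegration_of_card_le_near {c C r : ℝ} {μ : Measure unitInterval}
    [IsProbabilityMeasure μ] [NullSingletonClass μ] (hc : 0 < c) (hC : 0 ≤ C)
    (hlow : ∀ x y : unitInterval, x ≤ y → c * ((y : ℝ) - x) ≤ μ.real (Set.Ioc x y))
    (hup : ∀ x y : unitInterval, x ≤ y → μ.real (Set.Ioc x y) ≤ C * ((y : ℝ) - x))
    {n : ℕ} (hn : 0 < n) (hr : 0 ≤ r) {S : Set unitInterval}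
    (hS : ∀ a b : ℝ, 0 ≤ a → b ≤ 1 → a + r / 2 ≤ b → ∃ y ∈ S, a ≤ (y : ℝ) ∧ (y : ℝ) ≤ b)
    (x : Fin n → unitInterval)
    (hx : ∀ y ∈ S, |(Finset.card {i | x i ≤ y} : ℝ) - n * μ.real (Set.Iic y)| < n * (c * r / 2)) :
    ∃ κ : Kernel (Fin n) unitInterval,
      IsDisintegration μ (uniformOn (Set.univ : Set (Fin n))) (ballMultifunction r x) κ := by
  have hn' : (0 : ℝ) < n := by exact_mod_cast hn
  have hq : ∀ k : ℕ, ∃ q : unitInterval, k ≤ n → μ.real (Set.Iic q) = k / n := by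
    intro k
    by_cases hk : k ≤ n
    · obtain ⟨q, hq⟩ := exists_real_Iic_eq hC hup (t := (k : ℝ) / n)
        ⟨by positivity, div_le_one_of_le₀ (by exact_mod_cast hk) hn'.le⟩
      exact ⟨q, fun _ => hq⟩
    · exact ⟨0, fun h => absurd h hk⟩
  choose q hq using hq
  have hmono : ∀ y z : unitInterval, μ.real (Set.Iic y) < μ.real (Set.Iic z) → y < z := by
    intro y z h
    by_contra! h2
    exact absurd (measureReal_mono (μ := μ) (Set.Iic_subset_Iic.2 h2)) (not_le.2 h)
  have hqlt : ∀ k, k < n → q k < q (k + 1) := by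
    intro k hk
    apply hmono
    rw [hq k hk.le, hq (k + 1) hk]
    gcongr
    simp
  have hblock : ∀ k, k < n → μ.real (Set.Ioc (q k) (q (k + 1))) = 1 / n := by
    intro k hk
    rw [← real_Iic_sub_real_Iic (hqlt k hk).le, hq k hk.le, hq (k + 1) hk]
    push_cast; ring
  have hblock' : ∀ k, k < n → μ (Set.Ioc (q k) (q (k + 1))) = (n : ENNReal)⁻¹ := by
    intro k hk
    rw [← ofReal_measureReal, hblock k hk, one_div, ENNReal.ofReal_inv_of_pos hn',
      ENNReal.ofReal_natCast]
  have hn0 : (n : ENNReal) ≠ 0 := by exact_mod_cast hn.ne'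
  have hntop : (n : ENNReal) ≠ ⊤ := ENNReal.natCast_ne_top n
  have hsum : ∀ A : Set unitInterval, MeasurableSet A →
      ∑ k ∈ Finset.range n, μ (A ∩ Set.Ioc (q k) (q (k + 1))) = μ A := by
    intro A hA
    have hpart : ∀ k, k ≤ n → q 0 ≤ q k ∧ ∑ j ∈ Finset.range k,
        μ (A ∩ Set.Ioc (q j) (q (j + 1))) = μ (A ∩ Set.Ioc (q 0) (q k)) := by
      intro k
      induction k with
      | zero => simp
      | succ k ih =>
        intro hk
        obtain ⟨h1, h2⟩ := ih (by omega)
        refine ⟨h1.trans (hqlt k hk).le, ?_⟩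
        rw [Finset.sum_range_succ, h2, ← Set.Ioc_union_Ioc_eq_Ioc h1 (hqlt k hk).le,
          Set.inter_union_distrib_left, measure_union _ (hA.inter measurableSet_Ioc)]
        exact (Set.Ioc_disjoint_Ioc_of_le le_rfl).mono Set.inter_subset_right
          Set.inter_subset_right
    have h1 := hpart n le_rfl
    -- The half-open blocks need not cover `[0,1]`, but what they miss is null.
    have hnull : μ (Set.Ioc (q 0) (q n))ᶜ = 0 := by
      have h2 : μ.real (Set.Ioc (q 0) (q n)) = 1 := by
        rw [← real_Iic_sub_real_Iic h1.1, hq 0 (by omega), hq n le_rfl]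
        simp [hn'.ne']
      rw [← measureReal_eq_zero_iff, measureReal_compl measurableSet_Ioc, h2]
      simp
    rw [h1.2]
    exact measure_inter_conull hnull
  set σ := Tuple.sort x with hσ
  -- Order statistics are numbered from `0`, hence the strict inequality.
  have hcard : ∀ (k : Fin n) (y : unitInterval),
      (k : ℕ) < Finset.card {i | x i ≤ y} ↔ x (σ k) ≤ y := by
    intro k y
    have h := Tuple.lt_card_le_iff_apply_le_of_monotone (j := k) (a := y) (Tuple.monotone_sort x)
    rw [← hσ] at h
    have h2 : Finset.card {i | (x ∘ σ) i ≤ y} = Finset.card {i | x i ≤ y} := by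
      refine Finset.card_bij (fun i _ => σ i) ?_ ?_ ?_
      · simp
      · simp
      · intro b hb
        exact ⟨σ.symm b, by simpa using hb, by simp⟩
    rw [h2] at h
    exact h
  have hsupp : ∀ k : Fin n, Set.Ioc (q k) (q (k + 1)) ⊆ Metric.closedBall (x (σ k)) r := by
    intro k z hz
    have hzl : (k : ℝ) ≤ n * μ.real (Set.Iic z) := by
      have := measureReal_mono (μ := μ) (Set.Iic_subset_Iic.2 hz.1.le)
      rw [hq k k.2.le, div_le_iff₀ hn'] at this
      linarith
    have hzu : n * μ.real (Set.Iic z) ≤ k + 1 := by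
      have := measureReal_mono (μ := μ) (Set.Iic_subset_Iic.2 hz.2)
      rw [hq (k + 1) k.2, le_div_iff₀ hn'] at this
      push_cast at this
      linarith
    rw [Metric.mem_closedBall, Subtype.dist_eq, Real.dist_eq, abs_le]
    constructor
    -- Sample point too far right: it lies beyond a grid point `y ≥ z + r / 2`, so the count at `y`
    -- is at most `k`, while `n μ(Iic y) ≥ k + n * (c * r / 2)`.
    · by_contra! h
      obtain ⟨y, hy, hya, hyb⟩ := hS (z + r / 2) (z + r) (by have := z.2.1; linarith)
        (by have := (x (σ k)).2.2; linarith) (by linarith)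
      have h1 : ¬ x (σ k) ≤ y := by
        rw [not_le, ← Subtype.coe_lt_coe]; linarith
      rw [← hcard, not_lt] at h1
      have h2 : (Finset.card {i | x i ≤ y} : ℝ) ≤ k := by exact_mod_cast h1
      have hzy : z ≤ y := by rw [← Subtype.coe_le_coe]; linarith
      have h3 := hlow z y hzy
      rw [← real_Iic_sub_real_Iic hzy] at h3
      have h4 : c * (r / 2) ≤ c * ((y : ℝ) - z) := by gcongr; linarith
      have h5 := mul_le_mul_of_nonneg_left (h4.trans h3) hn'.le
      have h6 := (abs_lt.1 (hx y hy)).1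
      linarith
    -- Mirror case: the count at some `y ≤ z - r / 2` is at least `k + 1`, while `n μ(Iic y) ≤ k + 1
    -- - n * (c * r / 2)`.
    · by_contra! h
      obtain ⟨y, hy, hya, hyb⟩ := hS (z - r) (z - r / 2) (by have := (x (σ k)).2.1; linarith)
        (by have := z.2.2; linarith) (by linarith)
      have h1 : x (σ k) ≤ y := by
        rw [← Subtype.coe_le_coe]; linarith
      rw [← hcard, ← Nat.succ_le_iff] at h1
      have h2 : (k : ℝ) + 1 ≤ Finset.card {i | x i ≤ y} := by exact_mod_cast h1
      have hyz : y ≤ z := by rw [← Subtype.coe_le_coe]; linarith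
      have h3 := hlow y z hyz
      rw [← real_Iic_sub_real_Iic hyz] at h3
      have h4 : c * (r / 2) ≤ c * ((z : ℝ) - y) := by gcongr; linarith
      have h5 := mul_le_mul_of_nonneg_left (h4.trans h3) hn'.le
      have h6 := (abs_lt.1 (hx y hy)).2
      linarith
  have hpre : ∀ i : Fin n, multiPreimage (ballMultifunction r x) {i}
      = Metric.closedBall (x i) r := by
    intro i
    ext z
    simp [multiPreimage, ballMultifunction]
  refine ⟨Kernel.ofFunOfCountable fun i => (n : ENNReal) •
    μ.restrict (Set.Ioc (q (σ.symm i)) (q (σ.symm i + 1))), ?_, ⟨fun i => ⟨?_⟩⟩, ?_, ?_⟩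
  · intro B _
    have : multiPreimage (ballMultifunction r x) B = ⋃ i ∈ B, Metric.closedBall (x i) r := by
      ext z
      simp [multiPreimage, ballMultifunction, Set.Nonempty, and_comm]
    rw [this]
    exact MeasurableSet.biUnion B.to_countable fun i _ => measurableSet_closedBall
  · change ((n : ENNReal) • μ.restrict _) Set.univ = 1
    rw [Measure.smul_apply, Measure.restrict_apply_univ, hblock' _ (σ.symm i).2, smul_eq_mul,
      ENNReal.mul_inv_cancel hn0 hntop]
  · refine ae_of_all _ fun i => ?_
    rw [hpre]
    change ((n : ENNReal) • μ.restrict _) _ = 0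
    have h := hsupp (σ.symm i)
    rw [Equiv.apply_symm_apply] at h
    rw [Measure.smul_apply, Measure.restrict_apply measurableSet_closedBall.compl,
      (Set.disjoint_compl_left_iff_subset.2 h).inter_eq]
    simp
  · intro A hA
    change _ = ∫⁻ i, ((n : ENNReal) • μ.restrict _) A ∂_
    simp only [Measure.smul_apply, Measure.restrict_apply hA, smul_eq_mul]
    rw [uniformOn, ProbabilityTheory.cond, Measure.restrict_univ, lintegral_smul_measure, lintegral_count,
      tsum_fintype, ← Finset.mul_sum, Measure.count_univ,
      Equiv.sum_comp σ.symm fun k : Fin n => μ (A ∩ Set.Ioc (q k) (q (k + 1))),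
      Fin.sum_univ_eq_sum_range fun k => μ (A ∩ Set.Ioc (q k) (q (k + 1))), hsum A hA]
    simp only [ENat.card_eq_coe_fintype_card, Fintype.card_fin, ENat.toENNReal_coe, smul_eq_mul]
    rw [← mul_assoc, ENNReal.inv_mul_cancel hn0 hntop, one_mul]

/-! ### Concentration of the empirical counts -/

/-- Hoeffding's inequality for the number of sample points in a measurable set. -/
lemma real_le_abs_card_sub_le {Ω : Type*} {X : Type*} [MeasurableSpace Ω] [MeasurableSpace X]
    {P : Measure Ω} [IsProbabilityMeasure P] {μ : Measure X} {n : ℕ} (hn : 0 < n)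
    {ξ : Fin n → Ω → X} (hξ : ∀ i, Measurable (ξ i)) (hind : iIndepFun ξ P)
    (hlaw : ∀ i, P.map (ξ i) = μ) {A : Set X} [DecidablePred (· ∈ A)] (hA : MeasurableSet A)
    {δ : ℝ} (hδ : 0 ≤ δ) :
    P.real {ω | n * δ ≤ |(Finset.card {i | ξ i ω ∈ A} : ℝ) - n * μ.real A|}
      ≤ 2 * Real.exp (-2 * n * δ ^ 2) := by
  have hn' : (0 : ℝ) < n := by exact_mod_cast hn
  set g : X → ℝ := A.indicator 1 with hg
  have hgm : Measurable g := measurable_one.indicator hA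
  have hint : ∀ i, ∫ ω, g (ξ i ω) ∂P = μ.real A := by
    intro i
    rw [← integral_map (hξ i).aemeasurable hgm.aestronglyMeasurable, hlaw i, hg,
      integral_indicator_one hA]
  have hsub : ∀ i ∈ (Finset.univ : Finset (Fin n)),
      HasSubgaussianMGF (fun ω => g (ξ i ω) - μ.real A) ((‖(1 : ℝ) - 0‖₊ / 2) ^ 2) P := by
    intro i _
    rw [← hint i]
    refine hasSubgaussianMGF_of_mem_Icc (hgm.comp (hξ i)).aemeasurable (ae_of_all _ fun ω => ?_)
    by_cases h : ξ i ω ∈ A <;> simp [hg, h]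
  have hindg : iIndepFun (fun i ω => g (ξ i ω) - μ.real A) P :=
    hind.comp (fun _ z => g z - μ.real A) fun _ => hgm.sub_const _
  -- The negated variables give the lower tail.
  have hindg' : iIndepFun (fun i => -fun ω => g (ξ i ω) - μ.real A) P :=
    hindg.comp (fun _ z => -z) fun _ => measurable_neg
  have hsum : ∀ ω, ∑ i, (g (ξ i ω) - μ.real A)
      = (Finset.card {i | ξ i ω ∈ A} : ℝ) - n * μ.real A := by
    intro ω
    rw [Finset.sum_sub_distrib]
    simp [hg, Set.indicator_apply]
  have h0 : 0 ≤ n * δ := by positivity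
  have h1 := HasSubgaussianMGF.measure_sum_ge_le_of_iIndepFun hindg hsub h0
  have h2 := HasSubgaussianMGF.measure_sum_ge_le_of_iIndepFun hindg'
    (fun i hi => (hsub i hi).neg) h0
  -- Each centred indicator has variance proxy `1/4`, so the sum has `n/4`.
  have hexp : -(n * δ) ^ 2 / (2 * ((∑ _i : Fin n, (‖(1 : ℝ) - 0‖₊ / 2) ^ 2 : NNReal) : ℝ))
      = -2 * n * δ ^ 2 := by
    simp
    field_simp
  rw [hexp] at h1 h2
  calc _ ≤ P.real ({ω | n * δ ≤ ∑ i, (g (ξ i ω) - μ.real A)} ∪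
        {ω | n * δ ≤ ∑ i, (-fun ω => g (ξ i ω) - μ.real A) ω}) := by
        refine measureReal_mono fun ω hω => ?_
        simp only [Pi.neg_apply, Finset.sum_neg_distrib, Set.mem_union, Set.mem_ofPred_eq, hsum]
        exact le_abs.1 hω
    _ ≤ _ := (measureReal_union_le _ _).trans (by linarith)

/-! ### Grid and union bound -/

lemma exists_finset_grid {n : ℕ} (hn : 0 < n) :
    ∃ S : Finset unitInterval, S.card ≤ n + 1 ∧ ∀ a b : ℝ, 0 ≤ a → b ≤ 1 → a + 1 / n ≤ b →
      ∃ y ∈ S, a ≤ (y : ℝ) ∧ (y : ℝ) ≤ b := by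
  have hn' : (0 : ℝ) < n := by exact_mod_cast hn
  have hmem : ∀ j : Fin (n + 1), ((j : ℕ) : ℝ) / n ∈ unitInterval := fun j =>
    ⟨by positivity, div_le_one_of_le₀ (by exact_mod_cast Nat.lt_succ_iff.1 j.2) hn'.le⟩
  -- The grid is the multiples of `1/n`; the first one at or above `a` is still at most `b`.
  refine ⟨Finset.univ.image fun j : Fin (n + 1) => ⟨((j : ℕ) : ℝ) / n, hmem j⟩,
    Finset.card_image_le.trans (by simp), fun a b ha hb hab => ?_⟩
  have h1 := Nat.le_ceil (a * n)
  have h2 := Nat.ceil_lt_add_one (mul_nonneg ha hn'.le)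
  have h3 : (a + 1 / n) * n = a * n + 1 := by field_simp
  have h4 := mul_le_mul_of_nonneg_right hab hn'.le
  have h5 : (⌈a * n⌉₊ : ℝ) < n + 1 := by nlinarith
  refine ⟨_, Finset.mem_image_of_mem _ (Finset.mem_univ ⟨⌈a * n⌉₊, by exact_mod_cast h5⟩), ?_, ?_⟩
  · rw [le_div_iff₀ hn']; exact h1
  · rw [div_le_iff₀ hn']; linarith

lemma isDisintegrable_of_density {c C α : ℝ} (hc : 0 < c) (hα : 0 < α)
    {μ : Measure unitInterval} {f : unitInterval → ℝ} [IsProbabilityMeasure μ]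
    (hf : ∀ x, c ≤ f x ∧ f x ≤ C)
    (hμ : μ = (volume : Measure unitInterval).withDensity (fun x => ENNReal.ofReal (f x)))
    {n : ℕ} (hn : 2 ≤ n) :
    IsDisintegrable.{0, w} μ n ((n : ℝ) ^ (-α)) (intervalRadius c α n) := by
  intro Ω _ P _ ξ hξ hind hlaw
  have hn0 : 0 < n := by omega
  have hn' : (2 : ℝ) ≤ n := by exact_mod_cast hn
  have hC : 0 ≤ C := hc.le.trans ((hf 0).1.trans (hf 0).2)
  have : NullSingletonClass μ := by rw [hμ]; infer_instance
  have hlow : ∀ x y : unitInterval, x ≤ y → c * ((y : ℝ) - x) ≤ μ.real (Set.Ioc x y) :=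
    fun x y _ => mul_sub_le_real_Ioc_of_withDensity hc.le (fun z => (hf z).1) hμ x y
  have hup : ∀ x y : unitInterval, x ≤ y → μ.real (Set.Ioc x y) ≤ C * ((y : ℝ) - x) :=
    fun x y => real_Ioc_le_mul_sub_of_withDensity hC (fun z => (hf z).2) hμ
  -- Total mass `1` forces `c ≤ 1`, whence `s ≤ r / 2` and the mesh `1/n ≤ s` is fine enough.
  have hc1 : c ≤ 1 := by
    have := (hlow 0 1 zero_le_one).trans measureReal_le_one
    simpa using this
  have hlog : 1 / 2 ≤ Real.log n := by
    have := Real.log_le_log two_pos hn'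
    have := Real.log_two_gt_d9
    linarith
  set s := Real.sqrt ((2 + α) * (Real.log n / n)) with hs
  have hs2 : s ^ 2 = (2 + α) * (Real.log n / n) := Real.sq_sqrt (by positivity)
  have hs0 : 0 ≤ s := Real.sqrt_nonneg _
  set r := intervalRadius c α n with hr
  have hrs : r = 4 * c⁻¹ * s := rfl
  have hr0 : 0 ≤ r := by rw [hrs]; positivity
  have hcr : c * r / 2 = 2 * s := by rw [hrs]; field_simp; ring
  have hmesh : 1 / (n : ℝ) ≤ r / 2 := by
    have h1 : 1 / (n : ℝ) ≤ s := by
      refine Real.le_sqrt_of_sq_le ?_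
      rw [div_pow, one_pow, ← mul_div_assoc, div_le_div_iff₀ (by positivity) (by positivity)]
      have : 1 ≤ (2 + α) * Real.log n := by nlinarith
      nlinarith
    have h2 : 1 ≤ c⁻¹ := (one_le_inv₀ hc).2 hc1
    rw [hrs]
    nlinarith
  obtain ⟨S, hScard, hS⟩ := exists_finset_grid hn0
  let B : unitInterval → Set Ω := fun y =>
    {ω | n * (2 * s) ≤ |(Finset.card {i | ξ i ω ∈ Set.Iic y} : ℝ) - n * μ.real (Set.Iic y)|}
  have hBm : ∀ y, MeasurableSet (B y) := by
    intro y
    have hcm : Measurable fun ω => (Finset.card {i | ξ i ω ∈ Set.Iic y} : ℝ) := by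
      have : (fun ω => (Finset.card {i | ξ i ω ∈ Set.Iic y} : ℝ))
          = fun ω => ∑ i, (Set.Iic y).indicator (1 : unitInterval → ℝ) (ξ i ω) := by
        ext ω
        simp [Set.indicator_apply]
      rw [this]
      exact Finset.measurable_sum _ fun i _ =>
        (measurable_one.indicator measurableSet_Iic).comp (hξ i)
    exact measurableSet_le measurable_const (hcm.sub_const _).abs
  have hBP : ∀ y, P.real (B y) ≤ 2 * Real.exp (-2 * n * (2 * s) ^ 2) := fun y =>
    real_le_abs_card_sub_le hn0 hξ hind hlaw measurableSet_Iic (by positivity)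
  have hUm : MeasurableSet (⋃ y ∈ S, B y) := S.measurableSet_biUnion fun y _ => hBm y
  refine ⟨(⋃ y ∈ S, B y)ᶜ, hUm.compl, ?_, fun ω hω => ?_⟩
  · have hU : P.real (⋃ y ∈ S, B y) ≤ (n : ℝ) ^ (-α) := by
      -- The spare factor `n ^ (-3)` absorbs the union bound, as `2 * (n + 1) ≤ n ^ 3` for `n ≥ 2`.
      have hexp : Real.exp (-2 * n * (2 * s) ^ 2) ≤ (n : ℝ) ^ (-α) * ((n : ℝ) ^ 3)⁻¹ := by
        have h1 : (n : ℝ) ^ (-α) * ((n : ℝ) ^ 3)⁻¹ = Real.exp (-(α + 3) * Real.log n) := by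
          rw [← Real.rpow_natCast, ← Real.rpow_neg (by positivity),
            ← Real.rpow_add (by positivity), Real.rpow_def_of_pos (by positivity)]
          congr 1
          push_cast
          ring
        have h2 : -2 * n * (2 * s) ^ 2 = -8 * (2 + α) * Real.log n := by
          rw [mul_pow, hs2]
          field_simp
          ring
        rw [h1, h2, Real.exp_le_exp]
        nlinarith
      calc P.real (⋃ y ∈ S, B y) ≤ ∑ y ∈ S, P.real (B y) := measureReal_biUnion_finset_le _ _
        _ ≤ ∑ y ∈ S, 2 * Real.exp (-2 * n * (2 * s) ^ 2) := Finset.sum_le_sum fun y _ => hBP y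
        _ = S.card * (2 * Real.exp (-2 * n * (2 * s) ^ 2)) := by simp
        _ ≤ ((n : ℝ) + 1) * (2 * ((n : ℝ) ^ (-α) * ((n : ℝ) ^ 3)⁻¹)) := by
          gcongr
          exact_mod_cast hScard
        _ = (n : ℝ) ^ (-α) * ((2 * (n + 1)) / (n : ℝ) ^ 3) := by ring
        _ ≤ (n : ℝ) ^ (-α) * 1 := by
          gcongr
          rw [div_le_one (by positivity)]
          nlinarith [mul_self_nonneg ((n : ℝ) - 2)]
        _ = _ := mul_one _
    rw [measureReal_compl hUm, probReal_univ]
    linarith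
  · refine exists_isDisintegration_of_card_le_near hc hC hlow hup hn0 hr0 (S := S)
      (fun a b ha hb hab => hS a b ha hb (by linarith)) _ fun y hy => ?_
    rw [hcr]
    by_contra! h
    exact hω (Set.mem_biUnion hy h)

/-! ### Asymptotics of the radius and conclusion -/

lemma intervalRadius_eq {c α : ℝ} (hα : 0 < α) (n : ℕ) :
    intervalRadius c α n = 4 * c⁻¹ * Real.sqrt (2 + α) * Real.sqrt (Real.log n / n) := by
  rw [intervalRadius, Real.sqrt_mul (by positivity), mul_assoc (4 * c⁻¹)]

lemma tendsto_intervalRadius {c α : ℝ} (hα : 0 < α) :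
    Tendsto (intervalRadius c α) atTop (𝓝 0) := by
  have h1 : Tendsto (fun n : ℕ => Real.log n / n) atTop (𝓝 0) :=
    (Real.isLittleO_log_id_atTop.tendsto_div_nhds_zero).comp tendsto_natCast_atTop_atTop
  have h2 := (h1.sqrt).const_mul (4 * c⁻¹ * Real.sqrt (2 + α))
  rw [Real.sqrt_zero, mul_zero] at h2
  exact h2.congr fun n => (intervalRadius_eq hα n).symm

theorem theorem4p5 (c C α : ℝ) (hc : 0 < c) (hcC : c ≤ C) (hα : 0 < α) :
    (∃ n₀ : ℕ, ∀ (μ : Measure unitInterval) (f : unitInterval → ℝ),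
      IsProbabilityMeasure μ → Measurable f → (∀ x, c ≤ f x ∧ f x ≤ C) →
      μ = (volume : Measure unitInterval).withDensity (fun x => ENNReal.ofReal (f x)) →
      ∀ n : ℕ, n₀ ≤ n →
        IsDisintegrable.{0, w} μ n ((n : ℝ) ^ (-α)) (intervalRadius c α n)) ∧
    (∀ (μ : Measure unitInterval) (f : unitInterval → ℝ),
      IsProbabilityMeasure μ → Measurable f → (∀ x, c ≤ f x ∧ f x ≤ C) →
      μ = (volume : Measure unitInterval).withDensity (fun x => ENNReal.ofReal (f x)) →
      IsAsymptoticallyDisintegrable.{0, w} μ (fun n => (n : ℝ) ^ (-α)) (intervalRadius c α)) ∧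
    intervalRadius c α =O[atTop] (fun n : ℕ => Real.sqrt (Real.log n / n)) := by
  refine ⟨⟨2, fun μ f _ _ hf hμ n hn => isDisintegrable_of_density hc hα hf hμ hn⟩,
    fun μ f _ _ hf hμ => ⟨fun n _ => by positivity, fun n _ => ?_, ?_, tendsto_intervalRadius hα,
      ?_⟩, ?_⟩
  · unfold intervalRadius
    positivity
  · exact (tendsto_rpow_neg_atTop hα).comp tendsto_natCast_atTop_atTop
  · filter_upwards [eventually_ge_atTop 2] with n hn
    exact isDisintegrable_of_density hc hα hf hμ hn
  · rw [funext (intervalRadius_eq (c := c) hα)]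
    exact (isBigO_refl _ _).const_mul_left _
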